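/- For a monic polynomial $f=X^k-c_1X^{k-1}-\cdots-c_k\in\mathbb{Z}[X]$, let $\mathcal{L}(f)$ be the set of integer sequences $\boldsymbol{x}=(x_j)_{j\ge 0}$ that satisfy $x_j=c_1x_{j-1}+\cdots+c_kx_{j-k}$ for all $j\ge k$. For a positive integer $m$, let $\rho(\boldsymbol{x};m):=\#\{x_j \bmod m : j\ge 0\}$ be the number of distinct residues of $\boldsymbol{x}$ modulo $m$, and put $\mathcal{R}(f):=\{\rho(\boldsymbol{x};m) : \boldsymbol{x}\in\mathcal{L}(f),\ m\in\mathbb{Z}^+\}$. Let $a_1$ be a nonzero integer and let $f:=X^2-a_1X-1$. Then $\mathcal{R}(f)=\mathbb{Z}^+$; that is, for every positive integer $n$ there exist $\boldsymbol{x}\in\mathcal{L}(f)$ and $m\in\mathbb{Z}^+$ such that $\rho(\boldsymbol{x};m)=n$. Moreover, for every positive integer $n$, there exist $\boldsymbol{x}\in\mathcal{L}(f)$ and $m\in\mathbb{Z}^+$ such that $\rho(\boldsymbol{x};m)=n$ and $x_j\not\equiv 0\pmod m$ for all $j\ge 0$ if and only if either $|a_1|=1$ and $n\ge 4$, or $|a_1|\ge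 2$. -/

import Mathlib

open Polynomial

/-- The set `𝓛(f)` of all integer sequences `x₀, x₁, …` that are linear recurrences with
characteristic polynomial `f`. -/
def linearRecurrences (f : ℤ[X]) : Set (ℕ → ℤ) :=
  {x | ∃ E : LinearRecurrence ℤ, E.charPoly = f ∧ E.IsSolution x}

/-- `ρ(x; m)`, the number of distinct residues of the sequence `x` modulo `m`. -/
noncomputable def numResidues (x : ℕ → ℤ) (m : ℕ) : ℕ :=
  (Set.range fun k : ℕ => (x k : ZMod m)).ncard

/-- `𝓡(f)`, the set of all values `ρ(x; m)` for `x ∈ 𝓛(f)` and `m` a positive integer. -/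
def residueCounts (f : ℤ[X]) : Set ℕ :=
  {r | ∃ x ∈ linearRecurrences f, ∃ m : ℕ, 0 < m ∧ numResidues x m = r}

/-! Let `α`, `β` be the roots of `X ^ 2 - a X - 1`, so `αβ = -1`, and let `U`, `V` be the two Lucas
sequences. Solutions are purely periodic modulo `m`, and running one backwards replaces `a` by `-a`,
so `a ≥ 1` may be assumed (`HasNonzeroCount.neg`).

For `a = 1`, a zero-free solution with at most three residues would repeat the only nonzero
2-torsion residue, which is impossible (`four_le_of_hasNonzeroCount_one`); with zero allowed, `U`
modulo `n` has all `n` residues for `n ≤ 3`.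

The other counts come from constructions depending on `n` modulo 4. For odd `n`, the powers of a
root `r` of order `n` in `ZMod m` are used, with `m` the absolute norm of `α ^ n - 1` stripped of
its integer content (`exists_root_of_odd`). The second root `-1 / r` has order `2 n`. For `4 ∣ n`
and `a ≠ 2`, `V` modulo `(a ^ 2 + 4) U_k` with `k = n / 2 - 1` takes exactly the values `±V_0, …,
±V_k` (`hasNonzeroCount_four_dvd`). For `a = 2` this loses values since `V_0 = V_1`, and `1, 4, 9,
22, …` modulo `V_k` or `2 U_k`, `k = n / 4`, replaces it (`hasNonzeroCount_two_of_extra`). Finitely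
many small cases are computed. -/

/-- `x` satisfies the recurrence with characteristic polynomial `X ^ 2 - a X - 1`. -/
def IsRec (a : ℤ) (x : ℕ → ℤ) : Prop := ∀ j, x (j + 2) = a * x (j + 1) + x j

theorem mem_linearRecurrences_iff (a : ℤ) (x : ℕ → ℤ) :
    x ∈ linearRecurrences (X ^ 2 - C a * X - 1) ↔ IsRec a x := by
  constructor
  · rintro ⟨E, hE, hx⟩
    have hdeg : E.order = 2 := by
      have h1 := E.charPoly_degree_eq_order
      have h2 : (X ^ 2 - C a * X - 1 : ℤ[X]).degree = 2 := by compute_degree!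
      rw [hE, h2] at h1
      exact_mod_cast h1.symm
    obtain ⟨d, c⟩ := E
    obtain rfl : d = 2 := hdeg
    have h0 := congrArg (fun p => coeff p 0) hE
    have h1 := congrArg (fun p => coeff p 1) hE
    simp [LinearRecurrence.charPoly, Fin.sum_univ_two, coeff_monomial, coeff_one, coeff_X] at h0 h1
    simp [h0, coeff_one] at h1
    intro j
    have := hx j
    simp [Fin.sum_univ_two, h0, h1] at this
    rw [this]
    ring
  · intro hx
    refine ⟨⟨2, ![1, a]⟩, ?_, ?_⟩
    · simp [LinearRecurrence.charPoly, Fin.sum_univ_two, ← C_mul_X_pow_eq_monomial]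
      ring
    · intro j
      simp [Fin.sum_univ_two, hx j]
      ring

/-- Some solution of the recurrence has exactly `n` residues for some modulus, none of them zero. -/
def HasNonzeroCount (a : ℤ) (n : ℕ) : Prop :=
  ∃ x, IsRec a x ∧ ∃ m : ℕ, 0 < m ∧ numResidues x m = n ∧ ∀ k, (x k : ZMod m) ≠ 0

/-! ### Periodicity modulo `m` and time reversal. -/

theorem IsRec.ext {a : ℤ} {x y : ℕ → ℤ} {m : ℤ} (hx : IsRec a x) (hy : IsRec a y)
    (h0 : x 0 ≡ y 0 [ZMOD m]) (h1 : x 1 ≡ y 1 [ZMOD m]) (j : ℕ) : x j ≡ y j [ZMOD m] := by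
  induction j using Nat.twoStepInduction with
  | zero => exact h0
  | one => exact h1
  | more j ih ih' =>
    rw [hx, hy]
    exact (ih'.mul_left a).add ih

theorem IsRec.shift {a : ℤ} {x : ℕ → ℤ} (hx : IsRec a x) (k : ℕ) : IsRec a fun j => x (j + k) := by
  intro j
  have := hx (j + k)
  rwa [show j + k + 2 = j + 2 + k by ring, show j + k + 1 = j + 1 + k by ring] at this

theorem IsRec.neg {a : ℤ} {x : ℕ → ℤ} (hx : IsRec a x) : IsRec a fun j => -x j := by
  intro j
  simp only [hx j]
  ring

/-- The solution of the recurrence with prescribed initial values. -/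
def recSeq (a u v : ℤ) : ℕ → ℤ
  | 0 => u
  | 1 => v
  | n + 2 => a * recSeq a u v (n + 1) + recSeq a u v n

theorem isRec_recSeq (a u v : ℤ) : IsRec a (recSeq a u v) := fun _ => rfl

theorem exists_period (a : ℤ) (x : ℕ → ℤ) (hx : IsRec a x) (m : ℕ) (hm : 0 < m) :
    ∃ P, 2 ≤ P ∧ ∀ j, x (j + P) ≡ x j [ZMOD m] := by
  have : NeZero m := ⟨hm.ne'⟩
  let T : Equiv.Perm (ZMod m × ZMod m) :=
    { toFun := fun p => (p.2, a * p.2 + p.1)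
      invFun := fun p => (p.2 - a * p.1, p.1)
      left_inv := fun p => by simp
      right_inv := fun p => by simp }
  have hT : ∀ k, (T ^ k) ((x 0 : ZMod m), (x 1 : ZMod m)) = ((x k : ZMod m), (x (k + 1) : ZMod m)) := by
    intro k
    induction k with
    | zero => simp
    | succ k ih =>
      rw [pow_succ', Equiv.Perm.mul_apply, ih]
      simp [T, hx k]
  have hord : 0 < orderOf T := orderOf_pos T
  -- Doubling the order guarantees a period of at least 2.
  refine ⟨2 * orderOf T, by omega, ?_⟩
  have h := hT (2 * orderOf T)
  rw [mul_comm, pow_mul, pow_orderOf_eq_one, one_pow, Equiv.Perm.one_apply, Prod.mk.injEq] at h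
  rw [mul_comm 2]
  refine IsRec.ext (hx.shift _) hx ?_ ?_
  · rw [← ZMod.intCast_eq_intCast_iff]
    simpa using h.1.symm
  · rw [← ZMod.intCast_eq_intCast_iff]
    simpa [add_comm] using h.2.symm

theorem modEq_add_mul {x : ℕ → ℤ} {m : ℤ} {P : ℕ} (h : ∀ j, x (j + P) ≡ x j [ZMOD m]) (j k : ℕ) :
    x (j + k * P) ≡ x j [ZMOD m] := by
  induction k with
  | zero => simp
  | succ k ih =>
    rw [show j + (k + 1) * P = j + k * P + P by ring]
    exact (h _).trans ih

/-- Reversing a solution modulo `m` negates the middle coefficient of the recurrence. -/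
theorem HasNonzeroCount.neg {a : ℤ} {n : ℕ} (h : HasNonzeroCount a n) : HasNonzeroCount (-a) n := by
  obtain ⟨x, hx, m, hm, hn, hz⟩ := h
  obtain ⟨P, hP, hper⟩ := exists_period a x hx m hm
  obtain ⟨Q, rfl⟩ : ∃ Q, P = Q + 2 := ⟨P - 2, by omega⟩
  -- With period `P = Q + 2`, `j * (Q + 1) ≡ -j` modulo `P`, so `y j` plays the role of `x (-j)`.
  let y := recSeq (-a) (x 0) (x (Q + 1))
  have hy : ∀ j, y j ≡ x (j * (Q + 1)) [ZMOD m] := by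
    intro j
    induction j using Nat.twoStepInduction with
    | zero => simp [y, recSeq]
    | one => simp [y, recSeq]
    | more j ih ih' =>
      have h1 : y (j + 2) = -a * y (j + 1) + y j := rfl
      rw [h1]
      have h2 := hx ((j + 2) * (Q + 1))
      have h3 : x ((j + 2) * (Q + 1) + 1) ≡ x ((j + 1) * (Q + 1)) [ZMOD m] := by
        rw [show (j + 2) * (Q + 1) + 1 = (j + 1) * (Q + 1) + (Q + 2) by ring]
        exact hper _
      have h4 : x ((j + 2) * (Q + 1) + 2) ≡ x (j * (Q + 1)) [ZMOD m] := by
        rw [show (j + 2) * (Q + 1) + 2 = j * (Q + 1) + 2 * (Q + 2) by ring]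
        exact modEq_add_mul hper _ _
      have h5 : x ((j + 2) * (Q + 1)) =
          -a * x ((j + 2) * (Q + 1) + 1) + x ((j + 2) * (Q + 1) + 2) := by
        rw [h2]; ring
      rw [h5]
      exact ((ih'.trans h3.symm).mul_left _).add (ih.trans h4.symm)
  have hy' : ∀ j, (y j : ZMod m) = x (j * (Q + 1)) := fun j =>
    (ZMod.intCast_eq_intCast_iff _ _ _).2 (hy j)
  refine ⟨y, isRec_recSeq _ _ _, m, hm, ?_, fun k => by rw [hy']; exact hz _⟩
  rw [← hn]
  unfold numResidues
  congr 1
  ext t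
  constructor
  · rintro ⟨j, rfl⟩
    exact ⟨_, (hy' j).symm⟩
  · rintro ⟨j, rfl⟩
    refine ⟨j * (Q + 1), ?_⟩
    simp only [hy']
    rw [ZMod.intCast_eq_intCast_iff, show j * (Q + 1) * (Q + 1) = j + (j * Q) * (Q + 2) by ring]
    exact modEq_add_mul hper _ _

theorem hasNonzeroCount_neg_iff {a : ℤ} {n : ℕ} : HasNonzeroCount (-a) n ↔ HasNonzeroCount a n :=
  ⟨fun h => by simpa using h.neg, HasNonzeroCount.neg⟩

/-! ### Obstruction for `a = 1`. -/

theorem four_le_of_hasNonzeroCount_one {n : ℕ} (h : HasNonzeroCount 1 n) : 4 ≤ n := by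
  obtain ⟨x, hx, m, hm, hn, hz⟩ := h
  have : NeZero m := ⟨hm.ne'⟩
  by_contra hlt
  have hz' : ∀ j, (x (j + 2) : ZMod m) = x (j + 1) + x j := fun j => by simp [hx j]
  set y : ℕ → ZMod m := fun j => (x j : ZMod m) with hyd
  change ∀ j, y (j + 2) = y (j + 1) + y j at hz'
  change ∀ j, y j ≠ 0 at hz
  have h10 : ∀ j, y (j + 2) ≠ y (j + 1) := fun j e => hz j (by simpa [hz' j] using e)
  have h20 : ∀ j, y (j + 2) ≠ y j := fun j e => hz (j + 1) (by simpa [hz' j] using e)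
  -- Among four consecutive terms this is the only coincidence that `h10` and `h20` allow.
  have key : ∀ j, y (j + 4) = y (j + 1) := by
    intro j
    by_contra hne
    have hcard : ({y (j + 1), y (j + 2), y (j + 3), y (j + 4)} : Finset (ZMod m)).card = 4 := by
      have a1 := h10 j
      have a2 := h10 (j + 1)
      have a3 := h10 (j + 2)
      have b1 := h20 (j + 1)
      have b2 := h20 (j + 2)
      simp only [add_assoc, Nat.reduceAdd] at a1 a2 a3 b1 b2
      rw [Finset.card_insert_of_notMem, Finset.card_insert_of_notMem,
        Finset.card_insert_of_notMem, Finset.card_singleton] <;>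
      simp [a1.symm, a2.symm, a3.symm, b1.symm, b2.symm, Ne.symm hne]
    have hle : ({y (j + 1), y (j + 2), y (j + 3), y (j + 4)} : Finset (ZMod m)).card ≤ n := by
      rw [← hn, numResidues, ← Set.ncard_coe_finset]
      refine Set.ncard_le_ncard ?_ (Set.toFinite _)
      intro t
      simp only [Finset.coe_insert, Finset.coe_singleton, Set.mem_insert_iff,
        Set.mem_singleton_iff]
      rintro (rfl | rfl | rfl | rfl) <;> exact ⟨_, rfl⟩
    omega
  have hdouble : ∀ j, y (j + 2) + y (j + 2) = 0 := by
    intro j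
    have e := key j
    rw [hz' (j + 2), hz' (j + 1)] at e
    linear_combination e
  -- The only possible nonzero 2-torsion residue is `m / 2`.
  have hunique : ∀ s t : ZMod m, s + s = 0 → s ≠ 0 → t + t = 0 → t ≠ 0 → s = t := by
    intro s t hs hs0 ht ht0
    have hval : ∀ s : ZMod m, s + s = 0 → s ≠ 0 → 2 * s.val = m := by
      intro s hs hs0
      have h1 : ((2 * s.val : ℕ) : ZMod m) = 0 := by
        push_cast
        rw [ZMod.natCast_zmod_val, two_mul, hs]
      rw [ZMod.natCast_eq_zero_iff] at h1
      obtain ⟨c, hc⟩ := h1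
      have h2 := ZMod.val_lt s
      have h3 : s.val ≠ 0 := by rwa [Ne, ZMod.val_eq_zero]
      have hc2 : c < 2 := by
        by_contra hh
        have : m * 2 ≤ m * c := Nat.mul_le_mul_left _ (by omega)
        omega
      interval_cases c <;> omega
    apply ZMod.val_injective
    have := hval s hs hs0
    have := hval t ht ht0
    omega
  exact h10 1 (hunique _ _ (hdouble 1) (hz _) (hdouble 0) (hz _))

/-! ### Counting over one period, and explicit small cases. -/

theorem numResidues_pos (x : ℕ → ℤ) {m : ℕ} (hm : 0 < m) : 0 < numResidues x m := by
  have : NeZero m := ⟨hm.ne'⟩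
  exact (Set.ncard_pos (Set.toFinite _)).2 (Set.range_nonempty _)

theorem range_eq_image_of_period {x : ℕ → ℤ} {a : ℤ} {m P : ℕ} (hx : IsRec a x) (hP : 0 < P)
    (h0 : (x P : ZMod m) = x 0) (h1 : (x (P + 1) : ZMod m) = x 1) :
    (Set.range fun k => (x k : ZMod m)) =
      ((Finset.range P).image fun k => (x k : ZMod m) : Finset (ZMod m)) := by
  have hper : ∀ j, x (j + P) ≡ x j [ZMOD m] := by
    refine IsRec.ext (hx.shift P) hx ?_ ?_
    · rw [← ZMod.intCast_eq_intCast_iff]; simpa using h0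
    · rw [← ZMod.intCast_eq_intCast_iff]; simpa [add_comm] using h1
  ext t
  simp only [Set.mem_range, Finset.coe_image, Finset.coe_range, Set.mem_image, Set.mem_Iio]
  constructor
  · rintro ⟨j, rfl⟩
    refine ⟨j % P, Nat.mod_lt _ hP, ?_⟩
    rw [ZMod.intCast_eq_intCast_iff]
    have := modEq_add_mul hper (j % P) (j / P)
    rw [mul_comm, Nat.mod_add_div] at this
    exact this.symm
  · rintro ⟨j, -, rfl⟩
    exact ⟨j, rfl⟩

theorem hasNonzeroCount_of_period (a u v : ℤ) (m P n : ℕ) (hm : 0 < m) (hP : 0 < P)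
    (h0 : (recSeq a u v P : ZMod m) = recSeq a u v 0)
    (h1 : (recSeq a u v (P + 1) : ZMod m) = recSeq a u v 1)
    (hcard : ((Finset.range P).image fun k => (recSeq a u v k : ZMod m)).card = n)
    (hz : ∀ k ∈ Finset.range P, (recSeq a u v k : ZMod m) ≠ 0) : HasNonzeroCount a n := by
  have hr := range_eq_image_of_period (isRec_recSeq a u v) hP h0 h1
  refine ⟨_, isRec_recSeq a u v, m, hm, ?_, fun k hk => ?_⟩
  · rw [numResidues, hr, Set.ncard_coe_finset, hcard]
  · have : (recSeq a u v k : ZMod m) ∈ Set.range fun k => (recSeq a u v k : ZMod m) := ⟨k, rfl⟩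
    rw [hr] at this
    simp only [Finset.coe_image, Set.mem_image, Finset.mem_coe] at this
    obtain ⟨i, hi, hi'⟩ := this
    exact hz i hi (hi'.trans hk)

theorem hasNonzeroCount_one_six : HasNonzeroCount 1 6 :=
  hasNonzeroCount_of_period 1 1 3 8 12 6 (by decide) (by decide) (by decide) (by decide)
    (by decide) (by decide)

theorem hasNonzeroCount_two_two : HasNonzeroCount 2 2 :=
  hasNonzeroCount_of_period 2 1 1 4 4 2 (by decide) (by decide) (by decide) (by decide)
    (by decide) (by decide)

theorem hasNonzeroCount_two_four : HasNonzeroCount 2 4 :=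
  hasNonzeroCount_of_period 2 1 1 5 12 4 (by decide) (by decide) (by decide) (by decide)
    (by decide) (by decide)

theorem hasNonzeroCount_two_eight : HasNonzeroCount 2 8 :=
  hasNonzeroCount_of_period 2 1 4 10 12 8 (by decide) (by decide) (by decide) (by decide)
    (by decide) (by decide)

theorem hasNonzeroCount_two_twelve : HasNonzeroCount 2 12 :=
  hasNonzeroCount_of_period 2 1 1 13 28 12 (by decide) (by decide) (by decide) (by decide)
    (by decide) (by decide)

/-! ### Identities and growth of the Lucas sequences. -/

/-- The Lucas sequence `0, 1, a, a ^ 2 + 1, …`. -/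
def lucasU (a : ℤ) : ℕ → ℤ := recSeq a 0 1

/-- The companion Lucas sequence `2, a, a ^ 2 + 2, …`. -/
def lucasV (a : ℤ) : ℕ → ℤ := recSeq a 2 a

theorem isRec_lucasU (a : ℤ) : IsRec a (lucasU a) := isRec_recSeq _ _ _

theorem isRec_lucasV (a : ℤ) : IsRec a (lucasV a) := isRec_recSeq _ _ _

@[simp] theorem lucasU_zero (a : ℤ) : lucasU a 0 = 0 := rfl
@[simp] theorem lucasU_one (a : ℤ) : lucasU a 1 = 1 := rfl
@[simp] theorem lucasV_zero (a : ℤ) : lucasV a 0 = 2 := rfl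
@[simp] theorem lucasV_one (a : ℤ) : lucasV a 1 = a := rfl

/-- The second coefficient is `U_{n-1}`, written so as to make sense at `n = 0`. -/
theorem IsRec.add_index {a : ℤ} {x : ℕ → ℤ} (hx : IsRec a x) (n i : ℕ) :
    x (i + n) = lucasU a n * x (i + 1) + (lucasU a (n + 1) - a * lucasU a n) * x i := by
  induction n using Nat.twoStepInduction with
  | zero => simp
  | one => simp [isRec_lucasU a 0]
  | more n ih ih' =>
    rw [show i + (n + 2) = i + n + 2 by ring, hx, show i + n + 1 = i + (n + 1) by ring, ih, ih',
      show n + 2 + 1 = n + 1 + 2 by ring, isRec_lucasU a (n + 1), isRec_lucasU a n]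
    ring

theorem lucasU_norm (a : ℤ) (n : ℕ) :
    lucasU a (n + 1) ^ 2 - a * lucasU a n * lucasU a (n + 1) - lucasU a n ^ 2 = (-1) ^ n := by
  induction n with
  | zero => simp
  | succ n ih =>
    rw [isRec_lucasU a n, pow_succ]
    linear_combination -ih

theorem lucasV_eq (a : ℤ) (n : ℕ) : lucasV a n = 2 * lucasU a (n + 1) - a * lucasU a n := by
  rw [← zero_add n, (isRec_lucasV a).add_index n 0]
  simp
  ring

/-- Binet: for `x_j = A α ^ j + B β ^ j`, since `(-1) ^ n α ^ (-n) = β ^ n`, the left side is `(α ^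
n - β ^ n) (A α ^ s - B β ^ s)` with `s = i + n`. These reflections about `s` give the antiperiods
and symmetries used below. -/
theorem IsRec.add_two_mul_sub {a : ℤ} {x : ℕ → ℤ} (hx : IsRec a x) (n i : ℕ) :
    x (i + 2 * n) - (-1) ^ n * x i =
      lucasU a n * (2 * x (i + n + 1) - a * x (i + n)) := by
  rw [show i + 2 * n = i + n + n by ring, hx.add_index n (i + n),
    show i + n + 1 = i + 1 + n by ring, hx.add_index n (i + 1), hx.add_index n i,
    ← lucasU_norm a n, hx i]
  ring

theorem IsRec.add_two_mul_add {a : ℤ} {x : ℕ → ℤ} (hx : IsRec a x) (n i : ℕ) :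
    x (i + 2 * n) + (-1) ^ n * x i = lucasV a n * x (i + n) := by
  rw [show i + 2 * n = i + n + n by ring, hx.add_index n (i + n),
    show i + n + 1 = i + 1 + n by ring, hx.add_index n (i + 1), hx.add_index n i,
    ← lucasU_norm a n, hx i, lucasV_eq]
  ring

/-- Runs the recurrence backwards, in place of negative indices. -/
theorem IsRec.sub_index {a : ℤ} {x : ℕ → ℤ} (hx : IsRec a x) (i p : ℕ) :
    lucasU a (i + 1) * x (p + i) - lucasU a i * x (p + i + 1) = (-1) ^ i * x p := by
  rw [show p + i + 1 = p + 1 + i by ring, hx.add_index i (p + 1), hx.add_index i p,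
    ← lucasU_norm a i, hx p]
  ring

theorem two_mul_lucasV_succ_sub (a : ℤ) (n : ℕ) :
    2 * lucasV a (n + 1) - a * lucasV a n = (a ^ 2 + 4) * lucasU a n := by
  rw [lucasV_eq, lucasV_eq, isRec_lucasU a n]
  ring

theorem lucasU_succ_pos {a : ℤ} (ha : 1 ≤ a) (n : ℕ) :
    0 ≤ lucasU a n ∧ 1 ≤ lucasU a (n + 1) := by
  induction n with
  | zero => simp
  | succ n ih =>
    refine ⟨by linarith [ih.2], ?_⟩
    rw [isRec_lucasU a n]
    nlinarith [ih.1, ih.2]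

theorem lucasU_pos {a : ℤ} (ha : 1 ≤ a) {n : ℕ} (hn : 0 < n) : 1 ≤ lucasU a n := by
  obtain ⟨k, rfl⟩ : ∃ k, n = k + 1 := ⟨n - 1, by omega⟩
  exact (lucasU_succ_pos ha k).2

theorem lucasV_pos {a : ℤ} (ha : 1 ≤ a) (n : ℕ) : 1 ≤ lucasV a n := by
  induction n using Nat.twoStepInduction with
  | zero => simp
  | one => simpa
  | more n ih ih' =>
    rw [isRec_lucasV a n]
    nlinarith

theorem lucasV_lt_succ {a : ℤ} (ha : 1 ≤ a) {n : ℕ} (hn : 0 < n) :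
    lucasV a n < lucasV a (n + 1) := by
  obtain ⟨k, rfl⟩ : ∃ k, n = k + 1 := ⟨n - 1, by omega⟩
  rw [isRec_lucasV a k]
  nlinarith [lucasV_pos ha k, lucasV_pos ha (k + 1)]

theorem lucasV_le_of_le {a : ℤ} (ha : 1 ≤ a) {d n : ℕ} (hd : 0 < d) (hdn : d ≤ n) :
    lucasV a d ≤ lucasV a n := by
  induction n, hdn using Nat.le_induction with
  | base => exact le_rfl
  | succ n hn ih => exact ih.trans (lucasV_lt_succ ha (hd.trans_le hn)).le

theorem lucasV_three_mul {a : ℤ} {d : ℕ} (hd : Odd d) :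
    lucasV a (3 * d) = lucasV a d * (lucasV a d ^ 2 + 3) := by
  have h1 := (isRec_lucasV a).add_two_mul_add d d
  have h2 := (isRec_lucasV a).add_two_mul_add d 0
  rw [hd.neg_one_pow] at h1 h2
  rw [show d + 2 * d = 3 * d by ring, show d + d = 0 + 2 * d by ring] at h1
  simp only [lucasV_zero] at h2
  rw [zero_add d] at h2
  linear_combination h1 + lucasV a d * h2

/-! ### Odd `n` and `2 n`: geometric sequences. -/

theorem pow_succ_eq_of_root {R : Type*} [CommRing R] {a : ℤ} {r : R} (hr : r ^ 2 = a * r + 1)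
    (n : ℕ) : r ^ (n + 1) = lucasU a (n + 1) * r + lucasU a n := by
  induction n with
  | zero => simp
  | succ n ih =>
    rw [pow_succ, ih, isRec_lucasU a n]
    push_cast
    linear_combination (lucasU a (n + 1) : R) * hr

/-- `(U_{e} - 1) + U_{e + 1} α` is `α ^ (e + 1) - 1`, and its norm is `-V_{e + 1}` for `e` even. -/
theorem norm_pow_sub_one {a : ℤ} {e : ℕ} (he : Even e) :
    (lucasU a e - 1) ^ 2 + a * (lucasU a e - 1) * lucasU a (e + 1) - lucasU a (e + 1) ^ 2 =
      -lucasV a (e + 1) := by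
  have h := lucasU_norm a e
  rw [he.neg_one_pow] at h
  rw [lucasV_eq, isRec_lucasU a e]
  linear_combination -h

/-- Sending `α` to `r` kills `α ^ d - 1`, hence also its norm `-V_d`. -/
theorem dvd_lucasV_of_pow_eq_one {a : ℤ} {m d : ℕ} {r : ZMod m} (hr : r ^ 2 = a * r + 1)
    (hd : Odd d) (h : r ^ d = 1) : (m : ℤ) ∣ lucasV a d := by
  obtain ⟨e, rfl⟩ : ∃ e, d = e + 1 := ⟨d - 1, by have := hd.pos; omega⟩
  have he : Even e := by rw [Nat.odd_add_one] at hd; simpa using hd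
  rw [pow_succ_eq_of_root hr] at h
  rw [← ZMod.intCast_zmod_eq_zero_iff_dvd, ← neg_neg (lucasV a (e + 1)), ← norm_pow_sub_one he]
  push_cast
  have h' : (lucasU a e : ZMod m) - 1 = -(lucasU a (e + 1) * r) := by linear_combination h
  rw [h']
  linear_combination -(lucasU a (e + 1) : ZMod m) ^ 2 * hr

theorem exists_root_of_odd {a : ℤ} (ha : 1 ≤ a) {n : ℕ} (hn : Odd n) (h : 2 ≤ a ∨ 5 ≤ n) :
    ∃ m : ℕ, 0 < m ∧ ∃ r : ZMod m, r ^ 2 = a * r + 1 ∧ orderOf r = n := by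
  obtain ⟨e, rfl⟩ : ∃ e, n = e + 1 := ⟨n - 1, by have := hn.pos; omega⟩
  have he : Even e := by rw [Nat.odd_add_one] at hn; simpa using hn
  have hU := lucasU_pos ha (Nat.succ_pos e)
  -- Here `α ^ n - 1 = c (g + h' α)` with `n = e + 1`. The modulus will be minus the norm `N` of `g
  -- + h' α`, and `α` maps to `-g / h'`.
  obtain ⟨c, hc0, h', g, hcop, hh, hg⟩ : ∃ c : ℤ, 0 < c ∧ ∃ h g : ℤ, IsCoprime h g ∧
      lucasU a (e + 1) = c * h ∧ lucasU a e - 1 = c * g := by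
    have hpos : 0 < Int.gcd (lucasU a (e + 1)) (lucasU a e - 1) :=
      Int.gcd_pos_of_ne_zero_left _ (by simp at hU; omega)
    obtain ⟨h, g, hco, h1, h2⟩ := Int.exists_gcd_one hpos
    exact ⟨_, by exact_mod_cast hpos, h, g, Int.isCoprime_iff_gcd_eq_one.2 hco,
      h1.trans (mul_comm _ _), h2.trans (mul_comm _ _)⟩
  have hnorm := norm_pow_sub_one (a := a) he
  -- Modulo `c`, `lucasU_norm` reads `-1 ≡ 1`.
  have hc2 : c ∣ 2 := by
    have h1 := lucasU_norm a e
    rw [he.neg_one_pow, hh] at h1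
    have h2 : lucasU a e = c * g + 1 := by linarith
    rw [h2] at h1
    refine ⟨c * h' ^ 2 - a * (c * g + 1) * h' - c * g ^ 2 - 2 * g, ?_⟩
    linear_combination -h1
  have hc4 : c ^ 2 ≤ 4 := by
    have := Int.le_of_dvd (by norm_num) hc2
    nlinarith
  have hV := lucasV_pos ha (e + 1)
  set N := g ^ 2 + a * g * h' - h' ^ 2 with hN
  have hcN : c ^ 2 * N = -lucasV a (e + 1) := by
    rw [← hnorm, hh, hg, hN]; ring
  have hN0 : N < 0 := by
    by_contra hcon
    nlinarith [mul_nonneg (sq_nonneg c) (not_lt.1 hcon)]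
  have hm : ((N.natAbs : ℕ) : ℤ) = -N := by omega
  obtain ⟨u, v, huv⟩ : IsCoprime h' N := by
    have h1 : IsCoprime h' (g ^ 2) := hcop.pow_right
    have h2 : N = g ^ 2 + h' * (a * g - h') := by rw [hN]; ring
    rw [h2]
    exact h1.add_mul_left_right _
  have hNz : (N : ZMod N.natAbs) = 0 := by
    rw [ZMod.intCast_zmod_eq_zero_iff_dvd, hm]
    simp
  have hu : (u : ZMod N.natAbs) * h' = 1 := by
    have := congrArg (Int.cast : ℤ → ZMod N.natAbs) huv
    push_cast at this
    rw [hNz] at this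
    simpa using this
  have hNz' : (g : ZMod N.natAbs) ^ 2 + a * g * h' - h' ^ 2 = 0 := by
    rw [← hNz, hN]; push_cast; ring
  have hroot : (-(g * u : ZMod N.natAbs)) ^ 2 = a * (-(g * u)) + 1 := by
    linear_combination (u : ZMod N.natAbs) ^ 2 * hNz' +
      (-(a : ZMod N.natAbs) * g * u + u * h' + 1) * hu
  refine ⟨N.natAbs, by omega, -(g * u), hroot, ?_⟩
  have hone : (-(g * u : ZMod N.natAbs)) ^ (e + 1) = 1 := by
    rw [pow_succ_eq_of_root hroot, hh, show lucasU a e = c * g + 1 by linarith]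
    push_cast
    linear_combination -(c : ZMod N.natAbs) * g * hu
  have hdvd := orderOf_dvd_of_pow_eq_one hone
  set d := orderOf (-(g * u : ZMod N.natAbs)) with hd
  obtain ⟨q, hq⟩ := hdvd
  have hodd : Odd d ∧ Odd q := by rwa [hq, Nat.odd_mul] at hn
  rcases eq_or_ne q 1 with rfl | hq1
  · simpa using hq.symm
  exfalso
  -- As `m ∣ V_d` and `V_n = c ^ 2 m ≤ 4 V_d`, while `V_n ≥ V_{3d} = V_d (V_d ^ 2 + 3)`, it follows
  -- that `V_d = 1`. This contradicts `V_d ≥ V_1 = a` if `a ≥ 2`, and `V_n ≥ V_5 ≥ 11` if `n ≥ 5`.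
  have hq3 : 3 ≤ q := by
    obtain ⟨t, rfl⟩ := hodd.2
    omega
  have hdpos := hodd.1.pos
  have hle := lucasV_le_of_le ha (d := 3 * d) (n := e + 1) (by omega) (by
    rw [hq, mul_comm]; exact Nat.mul_le_mul_left _ hq3)
  rw [lucasV_three_mul hodd.1] at hle
  have hmV := Int.le_of_dvd (by linarith [lucasV_pos ha d])
    (dvd_lucasV_of_pow_eq_one hroot hodd.1 (pow_orderOf_eq_one _))
  rw [hm] at hmV
  have h4 : lucasV a (e + 1) ≤ 4 * lucasV a d := by nlinarith
  have hVd := lucasV_pos ha d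
  rcases hVd.lt_or_eq with h2 | h1
  · nlinarith
  · rcases h with h | h
    · have := lucasV_le_of_le ha (d := 1) one_pos hdpos
      simp at this
      omega
    · have h5 := lucasV_le_of_le ha (by norm_num) h
      have h6 : lucasV a 5 = a ^ 5 + 5 * a ^ 3 + 5 * a := by
        simp [isRec_lucasV a 3, isRec_lucasV a 2, isRec_lucasV a 1, isRec_lucasV a 0]
        ring
      have h7 : 1 ≤ a ^ 5 := one_le_pow₀ ha
      have h8 : 1 ≤ a ^ 3 := one_le_pow₀ ha
      linarith

theorem hasNonzeroCount_of_root {a : ℤ} {m : ℕ} (hm : 1 < m) {r : ZMod m}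
    (hr : r ^ 2 = a * r + 1) : HasNonzeroCount a (orderOf r) := by
  have : NeZero m := ⟨by omega⟩
  have : Fact (1 < m) := ⟨hm⟩
  have hunit : IsUnit r := IsUnit.of_mul_eq_one (r - a) (by linear_combination hr)
  have hx : ∀ k, ((recSeq a 1 r.val k : ℤ) : ZMod m) = r ^ k := by
    intro k
    induction k using Nat.twoStepInduction with
    | zero => simp [recSeq]
    | one => simp [recSeq]
    | more k ih ih' =>
      rw [recSeq, Int.cast_add, Int.cast_mul, ih, ih']
      linear_combination -r ^ k * hr
  refine ⟨_, isRec_recSeq a 1 r.val, m, by omega, ?_, fun k => ?_⟩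
  · rw [numResidues]
    simp only [hx]
    have hfin : IsOfFinOrder r := by
      obtain ⟨u, rfl⟩ := hunit
      exact (Units.coeHom _).isOfFinOrder (isOfFinOrder_of_finite u)
    have hset : (Set.range fun k => r ^ k) =
        ((Finset.range (orderOf r)).image fun k => r ^ k : Finset (ZMod m)) := by
      ext t
      simp only [Set.mem_range, Finset.coe_image, Finset.coe_range, Set.mem_image, Set.mem_Iio]
      constructor
      · rintro ⟨k, rfl⟩
        exact ⟨k % orderOf r, Nat.mod_lt _ hfin.orderOf_pos, pow_mod_orderOf _ _⟩
      · rintro ⟨k, -, rfl⟩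
        exact ⟨k, rfl⟩
    rw [hset, Set.ncard_coe_finset, Finset.card_image_of_injOn, Finset.card_range]
    simpa using pow_injOn_Iio_orderOf
  · rw [hx]
    exact (hunit.pow k).ne_zero

theorem orderOf_neg_of_odd {m : ℕ} (hm : 2 < m) {r : ZMod m} (h : Odd (orderOf r)) :
    orderOf (-r) = 2 * orderOf r := by
  have : Fact (2 < m) := ⟨hm⟩
  have h1 : orderOf (-1 : ZMod m) = 2 :=
    orderOf_eq_prime (by simp) (ZMod.neg_one_ne_one)
  rw [neg_eq_neg_one_mul, (Commute.all _ _).orderOf_mul_eq_mul_orderOf_of_coprime, h1]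
  rw [h1]
  exact h.coprime_two_left

theorem hasNonzeroCount_odd {a : ℤ} (ha : 1 ≤ a) {n : ℕ} (hn : Odd n)
    (h : 2 ≤ a ∧ 3 ≤ n ∨ 5 ≤ n) : HasNonzeroCount a n ∧ HasNonzeroCount a (2 * n) := by
  obtain ⟨m, hm, r, hr, ho⟩ := exists_root_of_odd ha hn (by omega)
  have : NeZero m := ⟨by omega⟩
  have hmn : n ≤ m := by
    simpa [ho, ZMod.card] using orderOf_le_card_univ (x := r)
  refine ⟨ho ▸ hasNonzeroCount_of_root (by omega) hr, ?_⟩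
  -- So `-(r - a)` is the other root `-1 / r`.
  have hinv : r * (r - a) = 1 := by linear_combination hr
  have ho' : orderOf (r - a) = n := by
    rw [← ho]
    have key : ∀ k, (r - a) ^ k = 1 ↔ r ^ k = 1 := by
      intro k
      have h1 : r ^ k * (r - a) ^ k = 1 := by rw [← mul_pow, hinv, one_pow]
      constructor <;> intro h2 <;> simpa [h2] using h1
    exact orderOf_eq_orderOf_iff.2 key
  have := orderOf_neg_of_odd (m := m) (r := r - a) (by omega) (ho'.symm ▸ hn)
  rw [ho'] at this
  rw [← this]
  exact hasNonzeroCount_of_root (by omega) (by linear_combination hr)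

/-- Modulo `a` the polynomial becomes `X ^ 2 - 1`, with root 1. -/
theorem hasNonzeroCount_self_one {a : ℤ} (ha : 2 ≤ a) : HasNonzeroCount a 1 := by
  have : (a : ZMod a.toNat) = 0 := by
    rw [ZMod.intCast_zmod_eq_zero_iff_dvd]
    simp [Int.toNat_of_nonneg (show 0 ≤ a by omega)]
  rw [← orderOf_one (G := ZMod a.toNat)]
  exact hasNonzeroCount_of_root (by omega) (by rw [this]; ring)

theorem hasNonzeroCount_self_two {a : ℤ} (ha : 3 ≤ a) : HasNonzeroCount a 2 := by
  have h0 : (a : ZMod a.toNat) = 0 := by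
    rw [ZMod.intCast_zmod_eq_zero_iff_dvd]
    simp [Int.toNat_of_nonneg (show 0 ≤ a by omega)]
  have := orderOf_neg_of_odd (m := a.toNat) (r := 1) (by omega) (by simp)
  rw [orderOf_one, mul_one] at this
  rw [← this]
  exact hasNonzeroCount_of_root (by omega) (by rw [h0]; ring)

/-! ### Multiples of 4 for `a ≠ 2`. -/

/-- A solution with `x (j + T) ≡ -x j` modulo `m` whose residues are, up to sign, the elements of a
finite set `W` of integers between `0` and `m / 2` takes exactly `2 * #W` residues. -/
theorem hasNonzeroCount_of_antiperiodic {a : ℤ} {x : ℕ → ℤ} (hx : IsRec a x) {m T : ℕ} (hm : 0 < m)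
    (hT : 0 < T) (hanti : ∀ j, x (j + T) ≡ -x j [ZMOD m]) (W : Finset ℤ)
    (hW : ∀ w ∈ W, 0 < w ∧ 2 * w < m)
    (hcov : ∀ j < T, ∃ w ∈ W, x j ≡ w [ZMOD m] ∨ x j ≡ -w [ZMOD m])
    (hmem : ∀ w ∈ W, ∃ j, x j ≡ w [ZMOD m] ∨ x j ≡ -w [ZMOD m]) :
    HasNonzeroCount a (2 * W.card) := by
  have hcov' : ∀ j, ∃ w ∈ W, x j ≡ w [ZMOD m] ∨ x j ≡ -w [ZMOD m] := by
    intro j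
    induction j using Nat.strong_induction_on with
    | _ j ih =>
      rcases lt_or_ge j T with h | h
      · exact hcov j h
      · obtain ⟨w, hw, hj⟩ := ih (j - T) (by omega)
        have h1 := hanti (j - T)
        rw [Nat.sub_add_cancel h] at h1
        refine ⟨w, hw, hj.symm.imp (fun h2 => ?_) fun h2 => h1.trans h2.neg⟩
        simpa using h1.trans h2.neg
  have hmem' : ∀ w ∈ W, (∃ j, x j ≡ w [ZMOD m]) ∧ ∃ j, x j ≡ -w [ZMOD m] := by
    intro w hw
    obtain ⟨j, hj | hj⟩ := hmem w hw
    · exact ⟨⟨j, hj⟩, j + T, (hanti j).trans hj.neg⟩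
    · exact ⟨⟨j + T, by simpa using (hanti j).trans hj.neg⟩, j, hj⟩
  set S : Finset ℤ := W ∪ W.image Neg.neg with hS
  have hSmem : ∀ s, s ∈ S ↔ s ∈ W ∨ -s ∈ W := by
    intro s
    simp only [hS, Finset.mem_union, Finset.mem_image]
    refine or_congr_right ⟨?_, fun h => ⟨_, h, neg_neg s⟩⟩
    rintro ⟨w, hw, rfl⟩
    simpa
  have hSb : ∀ s ∈ S, s ≠ 0 ∧ |2 * s| < m := by
    intro s hs
    rw [abs_lt]
    rcases (hSmem s).1 hs with h | h <;> have := hW _ h <;> refine ⟨?_, ?_, ?_⟩ <;> omega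
  have hScard : S.card = 2 * W.card := by
    rw [hS, Finset.card_union_of_disjoint, Finset.card_image_of_injective _ neg_injective, two_mul]
    rw [Finset.disjoint_left]
    intro s h1 h2
    obtain ⟨w, hw, rfl⟩ := Finset.mem_image.1 h2
    have := hW _ h1
    have := hW _ hw
    omega
  have hset : (Set.range fun k => (x k : ZMod m)) =
      (S.image fun s : ℤ => (s : ZMod m) : Finset (ZMod m)) := by
    ext t
    simp only [Set.mem_range, Finset.coe_image, Set.mem_image, Finset.mem_coe]
    constructor
    · rintro ⟨j, rfl⟩
      obtain ⟨w, hw, h | h⟩ := hcov' j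
      · exact ⟨w, (hSmem w).2 (Or.inl hw), (ZMod.intCast_eq_intCast_iff _ _ _).2 h.symm⟩
      · exact ⟨-w, (hSmem (-w)).2 (Or.inr (by simpa)), (ZMod.intCast_eq_intCast_iff _ _ _).2 h.symm⟩
    · rintro ⟨s, hs, rfl⟩
      rcases (hSmem s).1 hs with h | h
      · obtain ⟨j, hj⟩ := (hmem' _ h).1
        exact ⟨j, (ZMod.intCast_eq_intCast_iff _ _ _).2 hj⟩
      · obtain ⟨j, hj⟩ := (hmem' _ h).2
        exact ⟨j, (ZMod.intCast_eq_intCast_iff _ _ _).2 (by simpa using hj)⟩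
  refine ⟨x, hx, m, hm, ?_, fun k hk => ?_⟩
  · rw [numResidues, hset, Set.ncard_coe_finset, Finset.card_image_of_injOn, hScard]
    intro s hs t ht hst
    have h1 := abs_lt.1 (hSb s hs).2
    have h2 := abs_lt.1 (hSb t ht).2
    rw [ZMod.intCast_eq_intCast_iff_dvd_sub] at hst
    have := Int.eq_zero_of_abs_lt_dvd hst (by rw [abs_lt]; omega)
    omega
  · have h1 : (x k : ZMod m) ∈ Set.range fun k => (x k : ZMod m) := ⟨k, rfl⟩
    rw [hset] at h1
    simp only [Finset.coe_image, Set.mem_image, Finset.mem_coe] at h1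
    obtain ⟨s, hs, hs'⟩ := h1
    rw [hk, ZMod.intCast_zmod_eq_zero_iff_dvd] at hs'
    have h2 := abs_lt.1 (hSb s hs).2
    exact (hSb s hs).1 (Int.eq_zero_of_abs_lt_dvd hs' (by rw [abs_lt]; omega))

/-- Puts `V_k` below half the modulus, by `V_k ^ 2 = (a ^ 2 + 4) U_k ^ 2 - 4` and `4 < a ^ 2 + 4`.
-/
theorem two_mul_lucasV_lt {a : ℤ} (ha : 1 ≤ a) {k : ℕ} (hk : Odd k) :
    2 * lucasV a k < (a ^ 2 + 4) * lucasU a k := by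
  have hU := lucasU_pos ha hk.pos
  have hsq : lucasV a k ^ 2 = (a ^ 2 + 4) * lucasU a k ^ 2 - 4 := by
    have := lucasU_norm a k
    rw [hk.neg_one_pow] at this
    rw [lucasV_eq]
    linear_combination 4 * this
  refine lt_of_pow_lt_pow_left₀ 2 (by positivity) ?_
  have h1 : 1 ≤ a ^ 2 := one_le_pow₀ ha
  have h2 : 1 ≤ lucasU a k ^ 2 := one_le_pow₀ hU
  have h3 : 0 ≤ a ^ 2 * ((a ^ 2 + 4) * lucasU a k ^ 2) := by positivity
  have e1 : (2 * lucasV a k) ^ 2 = 4 * ((a ^ 2 + 4) * lucasU a k ^ 2) - 16 := by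
    rw [mul_pow, hsq]; ring
  have e2 : ((a ^ 2 + 4) * lucasU a k) ^ 2 = a ^ 2 * ((a ^ 2 + 4) * lucasU a k ^ 2) +
      4 * ((a ^ 2 + 4) * lucasU a k ^ 2) := by ring
  rw [e1, e2]
  linarith

theorem hasNonzeroCount_four_dvd {a : ℤ} (ha : 1 ≤ a) (ha2 : a ≠ 2) {k : ℕ} (hk : Odd k) :
    HasNonzeroCount a (2 * (k + 1)) := by
  have hkpos := hk.pos
  have hU := lucasU_pos ha hkpos
  have h1 : 1 ≤ a ^ 2 := one_le_pow₀ ha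
  obtain ⟨m, hm⟩ : ∃ m : ℕ, (m : ℤ) = (a ^ 2 + 4) * lucasU a k :=
    ⟨((a ^ 2 + 4) * lucasU a k).toNat, Int.toNat_of_nonneg (by positivity)⟩
  have hid : ∀ n i, lucasV a (i + 2 * n) - (-1) ^ n * lucasV a i =
      (a ^ 2 + 4) * (lucasU a n * lucasU a (i + n)) := by
    intro n i
    rw [(isRec_lucasV a).add_two_mul_sub n i, two_mul_lucasV_succ_sub]
    ring
  have hcard : ((Finset.range (k + 1)).image (lucasV a)).card = k + 1 := by
    rw [Finset.card_image_of_injOn, Finset.card_range]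
    have hlt : ∀ i j, 0 < i → i < j → lucasV a i < lucasV a j := fun i j hi hij =>
      (lucasV_lt_succ ha hi).trans_le (lucasV_le_of_le ha i.succ_pos hij)
    have h0 : ∀ i, 0 < i → lucasV a i ≠ 2 := by
      intro i hi
      rcases (show 1 ≤ i from hi).eq_or_lt with rfl | h
      · simpa
      · have := lucasV_le_of_le ha two_pos h
        have h2 : lucasV a 2 = a ^ 2 + 2 := by simp [isRec_lucasV a 0]; ring
        omega
    have hne : ∀ i j, i < j → lucasV a i ≠ lucasV a j := by
      intro i j hij
      rcases i.eq_zero_or_pos with rfl | hi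
      · exact (h0 j hij).symm
      · exact (hlt i j hi hij).ne
    intro i _ j _ hij
    by_contra hcon
    rcases lt_or_gt_of_ne hcon with h | h
    · exact hne _ _ h hij
    · exact hne _ _ h hij.symm
  rw [← hcard]
  have hmpos : 0 < m := by
    have : (0 : ℤ) < m := by rw [hm]; positivity
    exact_mod_cast this
  refine hasNonzeroCount_of_antiperiodic (isRec_lucasV a) (T := 2 * k) hmpos (by omega) ?_ _ ?_ ?_ ?_
  · intro j
    refine (Int.modEq_of_dvd ?_).symm
    have := hid k j
    rw [hk.neg_one_pow] at this
    rw [hm]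
    exact ⟨lucasU a (j + k), by linear_combination this⟩
  · intro w hw
    obtain ⟨i, hi, rfl⟩ := Finset.mem_image.1 hw
    refine ⟨lucasV_pos ha i, ?_⟩
    rw [hm]
    rcases i.eq_zero_or_pos with rfl | hi0
    · simp only [lucasV_zero]
      nlinarith
    · have := lucasV_le_of_le ha hi0 (Nat.lt_succ_iff.1 (Finset.mem_range.1 hi))
      have := two_mul_lucasV_lt ha hk
      linarith
  · intro j hj
    rcases le_or_gt j k with h | h
    · exact ⟨_, Finset.mem_image_of_mem _ (Finset.mem_range.2 (by omega)), Or.inl rfl⟩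
    -- Reflection about `k`: `V_{k+n} ≡ ±V_{k-n}`.
    · obtain ⟨n, rfl⟩ : ∃ n, j = k + n := ⟨j - k, by omega⟩
      obtain ⟨i, rfl⟩ : ∃ i, k = i + n := ⟨k - n, by omega⟩
      refine ⟨lucasV a i, Finset.mem_image_of_mem _ (Finset.mem_range.2 (by omega)), ?_⟩
      have hd : (m : ℤ) ∣ lucasV a (i + n + n) - (-1) ^ n * lucasV a i :=
        ⟨lucasU a n, by rw [hm, show i + n + n = i + 2 * n by ring, hid n i]; ring⟩
      rcases neg_one_pow_eq_or ℤ n with e | e <;> rw [e] at hd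
      · exact Or.inl (Int.modEq_of_dvd (by simpa using hd)).symm
      · exact Or.inr (Int.modEq_of_dvd (by simpa using hd)).symm
  · intro w hw
    obtain ⟨i, -, rfl⟩ := Finset.mem_image.1 hw
    exact ⟨i, Or.inl rfl⟩

/-! ### Multiples of 4 for `a = 2`: Pell numbers. -/

theorem pell_strictMono : StrictMono (lucasU 2) := by
  refine strictMono_nat_of_lt_succ fun n => ?_
  rcases n with _ | n
  · simp
  · rw [isRec_lucasU 2 n]
    linarith [lucasU_succ_pos (a := 2) (by norm_num) n]

theorem isRec_pell_forward : IsRec 2 fun i => lucasU 2 (i + 1) + 2 * lucasU 2 i := by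
  intro i
  simp only [isRec_lucasU 2 (i + 1), isRec_lucasU 2 i]
  ring

/-- Distinctness below rests on interlacing with the Pell numbers; the exception at `i = 0` is `1 =
U_1`, and for the backward values `2 = U_2`. -/
theorem pell_forward_bounds (i : ℕ) :
    lucasU 2 (i + 1) + 2 * lucasU 2 i < lucasU 2 (i + 2) ∧
      (0 < i → lucasU 2 (i + 1) < lucasU 2 (i + 1) + 2 * lucasU 2 i) := by
  have h0 := pell_strictMono i.lt_succ_self
  refine ⟨?_, fun hi => ?_⟩
  · have := isRec_lucasU 2 i
    have := pell_strictMono.monotone i.zero_le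
    simp at *
    linarith
  · linarith [lucasU_pos (a := 2) (by norm_num) hi]

theorem pell_backward_bounds (i : ℕ) :
    lucasU 2 (i + 1) < 2 * lucasU 2 (i + 1) - lucasU 2 i ∧
      (0 < i → 2 * lucasU 2 (i + 1) - lucasU 2 i < lucasU 2 (i + 2)) := by
  have h0 := pell_strictMono i.lt_succ_self
  refine ⟨by linarith, fun hi => ?_⟩
  have := isRec_lucasU 2 i
  linarith [lucasU_pos (a := 2) (by norm_num) hi]

theorem pell_backward_le (i : ℕ) : 2 * lucasU 2 (i + 1) - lucasU 2 i ≤ lucasU 2 (i + 2) := by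
  have := isRec_lucasU 2 i
  linarith [lucasU_succ_pos (a := 2) (by norm_num) i]

theorem pell_forward_ne {i j : ℕ} (hj : 3 ≤ j) :
    lucasU 2 (i + 1) + 2 * lucasU 2 i ≠ lucasU 2 j := by
  obtain ⟨h1, h2⟩ := pell_forward_bounds i
  intro he
  rcases lt_or_ge j (i + 2) with h | h
  · have := pell_strictMono.monotone (show j ≤ i + 1 by omega)
    have := h2 (by omega)
    omega
  · have := pell_strictMono.monotone h
    omega

theorem pell_backward_ne {i j : ℕ} (hj : 3 ≤ j) :
    2 * lucasU 2 (i + 1) - lucasU 2 i ≠ lucasU 2 j := by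
  obtain ⟨h1, h2⟩ := pell_backward_bounds i
  intro he
  rcases lt_or_ge j (i + 2) with h | h
  · have := pell_strictMono.monotone (show j ≤ i + 1 by omega)
    omega
  · rcases i.eq_zero_or_pos with rfl | hi
    · have := pell_strictMono (show 2 < j by omega)
      have := pell_backward_le 0
      simp at *
      omega
    · have := h2 hi
      have := pell_strictMono.monotone h
      omega

theorem pell_forward_ne_backward (i j : ℕ) :
    lucasU 2 (i + 1) + 2 * lucasU 2 i ≠ 2 * lucasU 2 (j + 1) - lucasU 2 j := by
  obtain ⟨h1, h2⟩ := pell_forward_bounds i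
  have h3 := (pell_backward_bounds j).1
  have h4 := pell_backward_le j
  intro he
  rcases lt_trichotomy i j with h | rfl | h
  · have := pell_strictMono.monotone (show i + 2 ≤ j + 1 by omega)
    omega
  · rcases i with _ | i
    · simp at he
    · have := isRec_lucasU 2 i
      have := pell_strictMono i.lt_succ_self
      simp only [Nat.succ_eq_add_one, add_assoc, Nat.reduceAdd] at *
      linarith
  · have := pell_strictMono.monotone (show j + 2 ≤ i + 1 by omega)
    have := h2 (by omega)
    omega

theorem pell_forward_strictMono :
    StrictMono fun i => lucasU 2 (i + 1) + 2 * lucasU 2 i := by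
  intro i j h
  have := pell_strictMono h
  have := pell_strictMono (Nat.succ_lt_succ h)
  simp only [Nat.succ_eq_add_one] at *
  linarith

theorem pell_backward_strictMono :
    StrictMono fun i => 2 * lucasU 2 (i + 1) - lucasU 2 i := by
  refine strictMono_nat_of_lt_succ fun i => ?_
  have := isRec_lucasU 2 i
  have := lucasU_succ_pos (a := 2) (by norm_num) i
  simp only [add_assoc, Nat.reduceAdd]
  linarith

/-- The residues of the Pell type sequence `1, 4, 9, 22, …` modulo `m` are, up to sign, its first
`l` terms, the `l` terms preceding them, and two more values `u` and `v`. -/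
theorem hasNonzeroCount_two_of_extra {l m : ℕ} (hl : 2 ≤ l) {u v : ℤ}
    (hanti : ∀ x, IsRec 2 x → ∀ j, x (j + 2 * (l + 1)) ≡ -x j [ZMOD m])
    (hm : 2 * lucasU 2 (l + 1) ≤ m) (hu : 0 < u ∧ 2 * u < m) (hv : 0 < v ∧ 2 * v < m) (huv : u ≠ v)
    (hum : lucasU 2 (l + 1) + 2 * lucasU 2 l = m - u)
    (hvm : 2 * lucasU 2 (l + 1) - lucasU 2 l = m - v)
    (hu' : ∀ i < l, lucasU 2 (i + 1) + 2 * lucasU 2 i ≠ u ∧ 2 * lucasU 2 (i + 1) - lucasU 2 i ≠ u)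
    (hv' : ∀ i < l, lucasU 2 (i + 1) + 2 * lucasU 2 i ≠ v ∧ 2 * lucasU 2 (i + 1) - lucasU 2 i ≠ v) :
    HasNonzeroCount 2 (4 * (l + 1)) := by
  set p : ℕ → ℤ := fun i => lucasU 2 (i + 1) + 2 * lucasU 2 i with hp
  set q : ℕ → ℤ := fun i => 2 * lucasU 2 (i + 1) - lucasU 2 i with hq
  set W : Finset ℤ := ((Finset.range l).image p ∪ (Finset.range l).image q) ∪ {u, v} with hW
  replace hum : p l = m - u := hum
  replace hvm : q l = m - v := hvm
  have hWmem : ∀ w, w ∈ W ↔ (∃ i < l, p i = w) ∨ (∃ i < l, q i = w) ∨ w = u ∨ w = v := by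
    intro w
    simp only [hW, Finset.mem_union, Finset.mem_image, Finset.mem_range, Finset.mem_insert,
      Finset.mem_singleton, or_assoc]
  have hcard : W.card = 2 * (l + 1) := by
    rw [hW, Finset.card_union_of_disjoint, Finset.card_union_of_disjoint,
      Finset.card_image_of_injective _ pell_forward_strictMono.injective,
      Finset.card_image_of_injective _ pell_backward_strictMono.injective, Finset.card_range,
      Finset.card_pair huv]
    · ring
    · rw [Finset.disjoint_left]
      intro w h1 h2
      obtain ⟨i, -, rfl⟩ := Finset.mem_image.1 h1
      obtain ⟨j, -, hj⟩ := Finset.mem_image.1 h2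
      exact pell_forward_ne_backward i j hj.symm
    · rw [Finset.disjoint_left]
      intro w h1 h2
      simp only [Finset.mem_union, Finset.mem_image, Finset.mem_range] at h1
      simp only [Finset.mem_insert, Finset.mem_singleton] at h2
      rcases h1 with ⟨i, hi, rfl⟩ | ⟨i, hi, rfl⟩ <;> rcases h2 with h2 | h2
      · exact (hu' i hi).1 h2
      · exact (hv' i hi).1 h2
      · exact (hu' i hi).2 h2
      · exact (hv' i hi).2 h2
  -- Up to sign `q i` is the term of index `-(i + 1)`, which the antiperiod moves to `j`.
  have hback : ∀ i j, i + 1 + j = 2 * (l + 1) →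
      p j ≡ q i [ZMOD m] ∨ p j ≡ -q i [ZMOD m] := by
    intro i j hij
    have h0 := hanti p isRec_pell_forward 0
    have h1 := hanti p isRec_pell_forward 1
    have h2 := IsRec.sub_index (x := p) isRec_pell_forward (i + 1) j
    rw [show j + (i + 1) + 1 = 1 + 2 * (l + 1) by omega,
      show j + (i + 1) = 0 + 2 * (l + 1) by omega] at h2
    have h3 : (-1) ^ (i + 1) * p j ≡ q i [ZMOD m] := by
      rw [← h2]
      refine ((h0.mul_left _).sub (h1.mul_left _)).trans ?_
      have h4 : lucasU 2 (i + 1 + 1) * -p 0 - lucasU 2 (i + 1) * -p 1 = q i := by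
        simp [hp, hq, isRec_lucasU 2 i, isRec_lucasU 2 0]
        ring
      rw [h4]
    rcases neg_one_pow_eq_or ℤ (i + 1) with e | e <;> rw [e] at h3
    · left; simpa using h3
    · right; simpa using h3.neg
  have hmpos : 0 < m := by omega
  rw [show 4 * (l + 1) = 2 * W.card by rw [hcard]; ring]
  refine hasNonzeroCount_of_antiperiodic isRec_pell_forward (T := 2 * (l + 1)) hmpos (by omega)
    (hanti _ isRec_pell_forward) W ?_ ?_ ?_
  · intro w hw
    have hpos := fun i => lucasU_succ_pos (a := 2) (by norm_num) i
    rcases (hWmem w).1 hw with ⟨i, hi, rfl⟩ | ⟨i, hi, rfl⟩ | rfl | rfl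
    · have h1 := (pell_forward_bounds i).1
      have h2 := pell_strictMono.monotone (show i + 2 ≤ l + 1 by omega)
      have h3 := hpos i
      simp only [hp]
      constructor <;> linarith
    · have h1 := (pell_backward_bounds i).1
      have h3 := hpos i
      have h4 : 2 * lucasU 2 (i + 1) - lucasU 2 i < lucasU 2 (l + 1) := by
        rcases i.eq_zero_or_pos with rfl | h0
        · exact (pell_backward_le 0).trans_lt (pell_strictMono (by omega))
        · exact ((pell_backward_bounds i).2 h0).trans_le (pell_strictMono.monotone (by omega))
      simp only [hq]
      constructor <;> linarith
    · exact hu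
    · exact hv
  · intro j hj
    rcases lt_trichotomy j l with h | rfl | h
    · exact ⟨p j, (hWmem _).2 (Or.inl ⟨j, h, rfl⟩), Or.inl rfl⟩
    · refine ⟨u, (hWmem _).2 (by simp), Or.inr ?_⟩
      exact (Int.modEq_of_dvd ⟨1, by linarith⟩).symm
    · obtain ⟨i, hi⟩ : ∃ i, i + 1 + j = 2 * (l + 1) := ⟨2 * (l + 1) - j - 1, by omega⟩
      have h1 := hback i j hi
      rcases (show i ≤ l by omega).lt_or_eq with h2 | rfl
      · exact ⟨q i, (hWmem _).2 (Or.inr (Or.inl ⟨i, h2, rfl⟩)), h1⟩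
      · refine ⟨v, (hWmem _).2 (by simp), ?_⟩
        have h3 : q i ≡ -v [ZMOD m] :=
          (Int.modEq_of_dvd ⟨1, by linarith⟩).symm
        exact h1.symm.imp (fun h => by simpa using h.trans h3.neg) fun h => h.trans h3
  · intro w hw
    rcases (hWmem w).1 hw with ⟨i, hi, rfl⟩ | ⟨i, hi, rfl⟩ | rfl | rfl
    · exact ⟨i, Or.inl rfl⟩
    · exact ⟨2 * (l + 1) - (i + 1), hback i _ (by omega)⟩
    · exact ⟨l, Or.inr (Int.modEq_of_dvd ⟨1, by linarith⟩).symm⟩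
    · have h3 : q l ≡ -w [ZMOD m] :=
        (Int.modEq_of_dvd ⟨1, by linarith⟩).symm
      exact ⟨l + 1, (hback l (l + 1) (by omega)).symm.imp
        (fun h => by simpa using h.trans h3.neg) fun h => h.trans h3⟩

theorem hasNonzeroCount_two_eight_dvd {k : ℕ} (hk : Even k) (hk4 : 4 ≤ k) :
    HasNonzeroCount 2 (4 * k) := by
  obtain ⟨l, rfl⟩ : ∃ l, k = l + 2 := ⟨k - 2, by omega⟩
  have hV := lucasV_pos (a := 2) (by norm_num) (l + 2)
  have hVe := lucasV_eq 2 (l + 2)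
  have r1 := isRec_lucasU 2 (l + 1)
  have r2 := isRec_lucasU 2 l
  have hl := lucasU_pos (a := 2) (by norm_num) (show 0 < l by omega)
  have hlt := pell_strictMono l.lt_succ_self
  simp only [add_assoc, Nat.reduceAdd, Nat.succ_eq_add_one] at *
  have hm : ((lucasV 2 (l + 2)).toNat : ℤ) = lucasV 2 (l + 2) := Int.toNat_of_nonneg (by omega)
  have hbound : ∀ i < l + 1, lucasU 2 (i + 1) + 2 * lucasU 2 i < lucasU 2 (l + 2) ∧
      2 * lucasU 2 (i + 1) - lucasU 2 i < lucasU 2 (l + 2) := by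
    intro i hi
    refine ⟨(pell_forward_bounds i).1.trans_le (pell_strictMono.monotone (by omega)), ?_⟩
    rcases i.eq_zero_or_pos with rfl | h0
    · exact (pell_backward_le 0).trans_lt (pell_strictMono (by omega))
    · exact ((pell_backward_bounds i).2 h0).trans_le (pell_strictMono.monotone (by omega))
  -- For even `k` the antiperiod `2 k` holds modulo `V_k = 2 U_k + 2 U_{k-1}`; `u` and `v` are `m`
  -- minus the two boundary terms.
  refine hasNonzeroCount_two_of_extra (l := l + 1) (m := (lucasV 2 (l + 2)).toNat)
    (u := lucasU 2 (l + 2)) (v := 3 * lucasU 2 (l + 1)) (by omega) ?_ ?_ ?_ ?_ ?_ ?_ ?_ ?_ ?_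
  · intro x hx j
    have := hx.add_two_mul_add (l + 2) j
    rw [hk.neg_one_pow] at this
    rw [hm]
    exact (Int.modEq_of_dvd ⟨x (j + (l + 2)), by linear_combination this⟩).symm
  · rw [hm]; linarith
  · rw [hm]; constructor <;> linarith
  · rw [hm]; constructor <;> linarith
  · intro h; linarith
  · rw [hm]; linarith
  · rw [hm]; linarith
  · intro i hi
    exact ⟨(hbound i hi).1.ne, (hbound i hi).2.ne⟩
  · intro i hi
    obtain ⟨h1, h2⟩ := hbound i hi
    constructor <;> intro h <;> linarith

theorem hasNonzeroCount_two_four_mul_odd {k : ℕ} (hk : Odd k) (hk5 : 5 ≤ k) :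
    HasNonzeroCount 2 (4 * k) := by
  obtain ⟨l, rfl⟩ : ∃ l, k = l + 2 := ⟨k - 2, by omega⟩
  have r2 := isRec_lucasU 2 l
  have hl := lucasU_pos (a := 2) (by norm_num) (show 0 < l by omega)
  have hlt := pell_strictMono l.lt_succ_self
  simp only [Nat.succ_eq_add_one] at hlt
  have hm : ((2 * lucasU 2 (l + 2)).toNat : ℤ) = 2 * lucasU 2 (l + 2) :=
    Int.toNat_of_nonneg (by omega)
  -- For `a = 2` the second factor in `IsRec.add_two_mul_sub` is even, so odd `k` allows the modulus
  -- `2 U_k`. Now `u` and `v` are Pell numbers of index at least 3.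
  refine hasNonzeroCount_two_of_extra (l := l + 1) (m := (2 * lucasU 2 (l + 2)).toNat)
    (u := lucasU 2 l) (v := lucasU 2 (l + 1)) (by omega) ?_ ?_ ?_ ?_ ?_ ?_ ?_ ?_ ?_
  · intro x hx j
    have := hx.add_two_mul_sub (l + 2) j
    rw [hk.neg_one_pow] at this
    rw [hm]
    exact (Int.modEq_of_dvd ⟨x (j + (l + 2) + 1) - x (j + (l + 2)),
      by linear_combination this⟩).symm
  · rw [hm]
  · rw [hm]; constructor <;> linarith
  · rw [hm]; constructor <;> linarith
  · intro h; linarith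
  · rw [hm]; simp only [add_assoc, Nat.reduceAdd] at *; linarith
  · rw [hm]
  · intro i _
    exact ⟨pell_forward_ne (by omega), pell_backward_ne (by omega)⟩
  · intro i _
    exact ⟨pell_forward_ne (by omega), pell_backward_ne (by omega)⟩

/-! ### Assembly of the cases. -/

theorem hasNonzeroCount_of_pos {a : ℤ} (ha : 1 ≤ a) {n : ℕ} (hn : 0 < n) (h : 2 ≤ a ∨ 4 ≤ n) :
    HasNonzeroCount a n := by
  rcases n.even_or_odd with ⟨t, rfl⟩ | hodd
  · rw [← two_mul] at *
    rcases t.even_or_odd with ⟨s, rfl⟩ | hodd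
    · obtain ⟨s, rfl⟩ : ∃ r, s = r + 1 := ⟨s - 1, by omega⟩
      by_cases ha2 : a = 2
      · subst ha2
        rw [show 2 * (s + 1 + (s + 1)) = 4 * (s + 1) by ring]
        rcases (s + 1).even_or_odd with he | ho
        · rcases lt_or_ge (s + 1) 4 with h4 | h4
          · obtain rfl : s = 1 := by obtain ⟨r, hr⟩ := he; omega
            exact hasNonzeroCount_two_eight
          · exact hasNonzeroCount_two_eight_dvd he h4
        · rcases lt_or_ge (s + 1) 5 with h5 | h5
          · obtain rfl | rfl : s = 0 ∨ s = 2 := by obtain ⟨r, hr⟩ := ho; omega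
            · exact hasNonzeroCount_two_four
            · exact hasNonzeroCount_two_twelve
          · exact hasNonzeroCount_two_four_mul_odd ho h5
      · have := hasNonzeroCount_four_dvd ha ha2 (k := 2 * s + 1) ⟨s, rfl⟩
        rwa [show 2 * s + 1 + 1 = s + 1 + (s + 1) by ring] at this
    · by_cases h3 : 2 ≤ a ∧ 3 ≤ t ∨ 5 ≤ t
      · exact (hasNonzeroCount_odd ha hodd h3).2
      · obtain ⟨r, rfl⟩ := hodd
        obtain ⟨rfl, rfl⟩ | ⟨rfl, h2⟩ : r = 1 ∧ a = 1 ∨ r = 0 ∧ 2 ≤ a := by omega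
        · exact hasNonzeroCount_one_six
        · rcases h2.eq_or_lt with rfl | h3
          · exact hasNonzeroCount_two_two
          · exact hasNonzeroCount_self_two h3
  · by_cases h3 : 2 ≤ a ∧ 3 ≤ n ∨ 5 ≤ n
    · exact (hasNonzeroCount_odd ha hodd h3).1
    · obtain ⟨r, rfl⟩ := hodd
      obtain ⟨rfl, h2⟩ : r = 0 ∧ 2 ≤ a := by omega
      exact hasNonzeroCount_self_one h2

theorem hasNonzeroCount_iff {a : ℤ} (ha : a ≠ 0) {n : ℕ} (hn : 0 < n) :
    HasNonzeroCount a n ↔ (|a| = 1 ∧ 4 ≤ n) ∨ 2 ≤ |a| := by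
  have key : ∀ b : ℤ, 1 ≤ b → (HasNonzeroCount b n ↔ (b = 1 ∧ 4 ≤ n) ∨ 2 ≤ b) := by
    intro b hb
    refine ⟨fun h => ?_, fun h => hasNonzeroCount_of_pos hb hn (by omega)⟩
    rcases hb.eq_or_lt with rfl | h2
    · exact Or.inl ⟨rfl, four_le_of_hasNonzeroCount_one h⟩
    · exact Or.inr h2
  rcases abs_choice a with h | h
  · have := key |a| (Int.one_le_abs ha)
    rw [← this, h]
  · have := key |a| (Int.one_le_abs ha)
    rw [← this, h, hasNonzeroCount_neg_iff]

/-- With `±1` as middle coefficient, `0, 1, ±1, …` has `n` residues modulo `n` for `n ≤ 3`. -/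
theorem numResidues_lucasU_of_abs_eq_one {a : ℤ} (ha : |a| = 1) {n : ℕ} (hn : 0 < n) (hn3 : n ≤ 3) :
    numResidues (lucasU a) n = n := by
  have hall : ∀ P : ℕ, 0 < P → (lucasU a P : ZMod n) = lucasU a 0 →
      (lucasU a (P + 1) : ZMod n) = lucasU a 1 →
      ((Finset.range P).image fun k => (lucasU a k : ZMod n)).card = n →
      numResidues (lucasU a) n = n := by
    intro P hP h0 h1 hc
    rw [numResidues, range_eq_image_of_period (isRec_lucasU a) hP h0 h1, Set.ncard_coe_finset, hc]
  rcases eq_or_eq_neg_of_abs_eq ha with rfl | rfl <;> interval_cases n <;>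
    -- The periods modulo 1, 2, 3 are 1, 3, 8, all dividing 24.
    exact hall 24 (by decide) (by decide) (by decide) (by decide)

theorem theorem1 (a₁ : ℤ) (ha₁ : a₁ ≠ 0) :
    residueCounts (X ^ 2 - C a₁ * X - 1) = {n : ℕ | 0 < n} ∧
    ∀ n : ℕ, 0 < n →
      ((∃ x ∈ linearRecurrences (X ^ 2 - C a₁ * X - 1), ∃ m : ℕ, 0 < m ∧
          numResidues x m = n ∧ ∀ k : ℕ, (x k : ZMod m) ≠ 0) ↔
        (|a₁| = 1 ∧ 4 ≤ n) ∨ 2 ≤ |a₁|) := by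
  simp only [mem_linearRecurrences_iff]
  refine ⟨?_, fun n hn => hasNonzeroCount_iff ha₁ hn⟩
  ext n
  simp only [residueCounts, mem_linearRecurrences_iff, Set.mem_ofPred_eq]
  constructor
  · rintro ⟨x, -, m, hm, rfl⟩
    exact numResidues_pos x hm
  · intro hn
    by_cases h : (|a₁| = 1 ∧ 4 ≤ n) ∨ 2 ≤ |a₁|
    · obtain ⟨x, hx, m, hm, hc, -⟩ := (hasNonzeroCount_iff ha₁ hn).2 h
      exact ⟨x, hx, m, hm, hc⟩
    · have := Int.one_le_abs ha₁
      exact ⟨_, isRec_lucasU a₁, n, hn, numResidues_lucasU_of_abs_eq_one (by omega) hn (by omega)⟩
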